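/- Let $\delta\ge 1$ be an integer. All graphs are finite and simple with positive integer edge weights $w_{xy}$; the strength of a vertex is $s_x=\sum_y w_{xy}$. Define $\mathcal W_n$, $n\ge 0$, as follows. $\mathcal W_0$ is the triangle with three edges of unit weight. For $n\ge 1$, $\mathcal W_n$ is obtained from $\mathcal W_{n-1}$, all of whose strengths are even, in two steps: (I) for each vertex $x$ of $\mathcal W_{n-1}$, of strength $s_x$ in $\mathcal W_{n-1}$, add $s_x/2$ new disjoint copies of the graph consisting of two vertices joined by an edge of unit weight, and join both vertices of each of these copies to $x$ by edges of unit weight; (II) increase the weight $w$ of each edge of $\mathcal W_{n-1}$ by $\delta w$. Let $N_n$ be the number of vertices of $\mathcal W_n$. On $\mathcal W_n$ consider the random walk that moves from $x$ to $y$ with probability $w_{xy}/s_x$. Let $H_{xy}$ be the expected first time $t\ge 0$ at which the walk started at $x$ is at $y$ (so $H_{xx}=0$), let $\pi_y=s_y/\sum_z s_z$ be the stationary distribution, and let $H_n=\sum_y \pi_y H_{xy}$ be the mean hitting time. Then for every $n\ge 0$ and every starting vertex $x$ of $\mathcal W_n$ the value of $H_n$ is finite, does not depend on $x$, and $$H_n=\frac{4\delta(\delta+1)^{n+1}+24(\delta+4)^n(\delta+1)^{n+1}-12(\delta+2)(\delta+4)^n}{3\delta(\delta+4)(\delta+1)^n}.$$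 Moreover $H_n$ grows linearly in the number of vertices: for each $\delta$ there is a constant $c>0$ with $H_n/N_n\to c$ as $n\to\infty$. -/

import Mathlib

open MeasureTheory ProbabilityTheory Filter Topology
open scoped ENNReal

/-- A finite simple graph with positive integer edge weights, encoded by its symmetric weight
function: `w x y` is the weight of the edge `xy`, and `w x y = 0` means that `xy` is not an edge. -/
structure WeightedGraph where
  V : Type
  [instFintype : Fintype V]
  [instDecidableEq : DecidableEq V]
  w : V → V → ℕ
  symm : ∀ x y, w x y = w y x
  loopless : ∀ x, w x x = 0

namespace WeightedGraph

attribute [instance] WeightedGraph.instFintype WeightedGraph.instDecidableEq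

/-- The strength `s_x = ∑_y w_{xy}` of a vertex. -/
def strength (G : WeightedGraph) (x : G.V) : ℕ := ∑ y, G.w x y

/-- The complete graph on `k` vertices with unit edge weights. -/
abbrev unitComplete (k : ℕ) : WeightedGraph where
  V := Fin k
  w x y := if x = y then 0 else 1
  symm x y := by simp only [eq_comm]
  loopless x := by simp

/-- Vertices of the extended corona product: the vertices of `G₁` and, for each vertex `i` of `G₁`
and each of the `s_i / 2` copies of `G₂` attached to `i`, the vertices of that copy.
A copy is named by a pair `⟨i, k⟩` with `k < s_i / 2`. -/
abbrev CoronaVertex (G₁ G₂ : WeightedGraph) : Type :=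
  G₁.V ⊕ ((Σ i : G₁.V, Fin (G₁.strength i / 2)) × G₂.V)

/-- Weights of the extended corona product. -/
def coronaWeight (G₁ G₂ : WeightedGraph) : CoronaVertex G₁ G₂ → CoronaVertex G₁ G₂ → ℕ
  | .inl x, .inl y => G₁.w x y
  | .inl x, .inr (c, _) => if c.1 = x then 1 else 0
  | .inr (c, _), .inl x => if c.1 = x then 1 else 0
  | .inr (c, u), .inr (c', v) => if c = c' then G₂.w u v else 0

/-- The extended corona product: for each vertex `i` of `G₁`, of (even) strength `s_i`, take
`s_i / 2` copies of `G₂` and link all their vertices to `i` by edges of unit weight. -/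
abbrev corona (G₁ G₂ : WeightedGraph) : WeightedGraph where
  V := CoronaVertex G₁ G₂
  w := coronaWeight G₁ G₂
  symm := by
    rintro (x | ⟨c, u⟩) (y | ⟨c', v⟩) <;> simp only [coronaWeight]
    · exact G₁.symm x y
    · rw [G₂.symm u v]; simp only [eq_comm]
  loopless := by
    rintro (x | ⟨c, u⟩) <;> simp [coronaWeight, G₁.loopless, G₂.loopless]

/-- Add `δ * w` to the weight `w` of every edge of the corona product that belongs to `G₁`. -/
def reinforcedWeight (δ : ℕ) (G₁ G₂ : WeightedGraph) :
    CoronaVertex G₁ G₂ → CoronaVertex G₁ G₂ → ℕ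
  | .inl x, .inl y => coronaWeight G₁ G₂ (.inl x) (.inl y)
      + δ * coronaWeight G₁ G₂ (.inl x) (.inl y)
  | p, q => coronaWeight G₁ G₂ p q

/-- One growth step: the extended corona product with the one-edge graph `K₂` of unit weight,
followed by the reinforcement of all old edges. -/
abbrev grow (δ : ℕ) (G : WeightedGraph) : WeightedGraph where
  V := CoronaVertex G (unitComplete 2)
  w := reinforcedWeight δ G (unitComplete 2)
  symm := by
    have h := (corona G (unitComplete 2)).symm
    rintro (x | p) (y | q)
    · exact congrArg (fun t => t + δ * t) (h (.inl x) (.inl y))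
    · exact h (.inl x) (.inr q)
    · exact h (.inr p) (.inl y)
    · exact h (.inr p) (.inr q)
  loopless := by
    have h := (corona G (unitComplete 2)).loopless
    rintro (x | p)
    · have hx : coronaWeight G (unitComplete 2) (.inl x) (.inl x) = 0 := h (.inl x)
      simp [reinforcedWeight, hx]
    · exact h (.inr p)

/-- The iteratively growing weighted networks `W_n` with parameter `δ`: `W_0` is the triangle
with unit weights. -/
def network (δ : ℕ) : ℕ → WeightedGraph
  | 0 => unitComplete 3
  | n + 1 => grow δ (network δ n)

theorem strength_grow_inl (δ : ℕ) (G : WeightedGraph) (hG : ∀ x, Even (G.strength x)) (x : G.V) :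
    (grow δ G).strength (Sum.inl x : CoronaVertex G (unitComplete 2))
      = (δ + 2) * G.strength x := by
  have h1 : (grow δ G).strength (Sum.inl x : CoronaVertex G (unitComplete 2))
      = ∑ q : CoronaVertex G (unitComplete 2),
          reinforcedWeight δ G (unitComplete 2) (.inl x) q := rfl
  have h2 : ∑ q : (Σ i : G.V, Fin (G.strength i / 2)) × Fin 2, (if q.1.1 = x then 1 else 0)
      = G.strength x := by
    rw [Fintype.sum_prod_type, Fintype.sum_sigma, Finset.sum_eq_single x]
    · have := Nat.two_mul_div_two_of_even (hG x)
      simp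
      omega
    · intro y _ hy
      simp [hy]
    · simp
  rw [h1, Fintype.sum_sum_type]
  have h3 : ∑ q : (Σ i : G.V, Fin (G.strength i / 2)) × (unitComplete 2).V,
      reinforcedWeight δ G (unitComplete 2) (.inl x) (.inr q) = G.strength x := h2
  rw [h3]
  simp only [reinforcedWeight, coronaWeight, Finset.sum_add_distrib, ← Finset.mul_sum]
  simp only [strength]
  ring

theorem strength_grow_inr (δ : ℕ) (G : WeightedGraph)
    (c : Σ i : G.V, Fin (G.strength i / 2)) (u : Fin 2) :
    (grow δ G).strength (Sum.inr (c, u) : CoronaVertex G (unitComplete 2)) = 2 := by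
  have h1 : (grow δ G).strength (Sum.inr (c, u) : CoronaVertex G (unitComplete 2))
      = ∑ q : CoronaVertex G (unitComplete 2),
          reinforcedWeight δ G (unitComplete 2) (.inr (c, u)) q := rfl
  have h2 : ∑ q : (Σ i : G.V, Fin (G.strength i / 2)) × Fin 2,
      (if c = q.1 then (if u = q.2 then 0 else 1) else 0) = 1 := by
    rw [Fintype.sum_prod_type]
    simp only [Fin.sum_univ_two]
    fin_cases u <;> simp
  have h3 : ∑ q : (Σ i : G.V, Fin (G.strength i / 2)) × (unitComplete 2).V,
      reinforcedWeight δ G (unitComplete 2) (.inr (c, u)) (.inr q) = 1 := h2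
  rw [h1, Fintype.sum_sum_type, h3]
  simp [reinforcedWeight, coronaWeight]

/-- All strengths in the networks are even and positive, so that the corona product is always
formed from graphs with even strengths and no vertex is isolated. -/
theorem network_strength (δ n : ℕ) (x : (network δ n).V) :
    Even ((network δ n).strength x) ∧ 0 < (network δ n).strength x := by
  induction n with
  | zero =>
    have h : (network δ 0).strength x = 2 := by
      change Fin 3 at x
      change ∑ y : Fin 3, (if x = y then 0 else 1) = 2
      fin_cases x <;> rfl
    simp [h]
  | succ n ih =>
    change CoronaVertex (network δ n) (unitComplete 2) at x
    change Even ((grow δ (network δ n)).strength x) ∧ 0 < (grow δ (network δ n)).strength x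
    rcases x with x | ⟨c, u⟩
    · rw [strength_grow_inl δ _ (fun y => (ih y).1) x]
      exact ⟨(ih x).1.mul_left _, Nat.mul_pos (by omega) (ih x).2⟩
    · have h := strength_grow_inr δ (network δ n) c u
      exact ⟨(congrArg Even h).mpr even_two, two_pos.trans_eq h.symm⟩

instance (G : WeightedGraph) : MeasurableSpace G.V := ⊤

instance (G : WeightedGraph) : DiscreteMeasurableSpace G.V := ⟨fun _ => trivial⟩

/-- Transition probability `w_{xy} / s_x` of the biased random walk. (At an isolated vertex, which
does not occur in a connected graph with an edge, the walker is made to stay.) -/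
noncomputable def transition (G : WeightedGraph) (x y : G.V) : ℝ≥0∞ :=
  if G.strength x = 0 then (if y = x then 1 else 0) else (G.w x y : ℝ≥0∞) / (G.strength x : ℝ≥0∞)

theorem sum_transition (G : WeightedGraph) (x : G.V) : ∑ y, G.transition x y = 1 := by
  by_cases h : G.strength x = 0
  · simp [transition, h]
  · simp only [transition, h, if_false, div_eq_mul_inv, ← Finset.sum_mul]
    rw [← Nat.cast_sum]
    exact ENNReal.mul_inv_cancel (by exact_mod_cast h) (ENNReal.natCast_ne_top _)

/-- The law of the next position of the walker at `x`. -/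
noncomputable def stepLaw (G : WeightedGraph) (x : G.V) : PMF G.V :=
  PMF.ofFintype (G.transition x) (G.sum_transition x)

/-- The transition kernel of the biased random walk, reading the history up to time `n` only
through the present position. -/
noncomputable def stepKernel (G : WeightedGraph) (n : ℕ) :
    Kernel (Finset.Iic n → G.V) G.V where
  toFun h := (G.stepLaw (h ⟨n, Finset.mem_Iic.2 le_rfl⟩)).toMeasure
  measurable' := measurable_of_countable _

instance (G : WeightedGraph) (n : ℕ) : IsMarkovKernel (G.stepKernel n) :=
  ⟨fun _ => inferInstanceAs (IsProbabilityMeasure (G.stepLaw _).toMeasure)⟩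

/-- The law, on the space of infinite trajectories, of the biased random walk started at `x`. -/
noncomputable def walkLaw (G : WeightedGraph) (x : G.V) : Measure (ℕ → G.V) :=
  Kernel.traj (X := fun _ => G.V) G.stepKernel 0 (fun _ => x)

/-- The hitting time `H_{xy}`: the expectation of the first time `≥ 0` (infinite if there is none)
at which the walk started at `x` is at `y`. -/
noncomputable def hittingTime (G : WeightedGraph) (x y : G.V) : ℝ≥0∞ :=
  ∫⁻ ω, ENat.toENNReal (hittingAfter (fun (k : ℕ) (ω : ℕ → G.V) => ω k) {y} 0 ω) ∂G.walkLaw x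

/-- The stationary distribution `π_y = s_y / ∑_z s_z`. -/
noncomputable def stationary (G : WeightedGraph) (y : G.V) : ℝ≥0∞ :=
  (G.strength y : ℝ≥0∞) / (∑ z, G.strength z : ℕ)

/-- The mean hitting time `∑_y π_y H_{xy}` of the walk started at `x`. -/
noncomputable def meanHittingTime (G : WeightedGraph) (x : G.V) : ℝ≥0∞ :=
  ∑ y, G.stationary y * G.hittingTime x y

end WeightedGraph

/-! Write `G` for one network and `S` for its total strength. The full matrix of hitting times is
carried through a growth step, since its weighted row sums are what the theorem asks for.
`IsHittingMatrix` records the first-step equations off the diagonal and Kac's return time `S / s_y`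
on it. A finite nonnegative solution must be the matrix of hitting times
(`hittingTime_eq_of_firstStep`), so explicit candidates suffice.

The candidate `growHit` comes from watching the grown walk at old vertices only. An excursion into a
new triangle starts with probability `1/(δ+2)` and, once inside, needs 2 steps on average to return.
So one step of the old walk costs `a = (δ+4)/(δ+1)` on average, and old hitting times are multiplied
by `a`. Reaching a new vertex means reaching its attachment vertex and then spending `D =
attachTime`.

The stationary mass of the new vertices is `2/(δ+4)`, distributed over attachment vertices like the
old stationary law. Hence the mean satisfies `K' = a K + 2 D/(δ+4)`, which is `kemeny_succ`. The
total strength is multiplied by `δ+4` at each step, and both `K` and the number of vertices grow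
like `(δ+4)^n`. -/

theorem ENat.toENNReal_eq_tsum_ite (m : ℕ∞) :
    (m : ℝ≥0∞) = ∑' k : ℕ, if (k : ℕ∞) < m then 1 else 0 := by
  induction m using ENat.recTopCoe with
  | top => simp
  | coe n =>
    rw [tsum_eq_sum (s := Finset.range n) (by intro k hk; simpa using hk),
      Finset.sum_congr rfl (g := fun _ => (1 : ℝ≥0∞))
        (by intro k hk; simpa using hk)]
    simp

/-! ### Hitting times of the walk and first-step equations -/

namespace WeightedGraph

variable (G : WeightedGraph)

instance (x : G.V) : IsProbabilityMeasure (G.walkLaw x) :=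
  inferInstanceAs (IsProbabilityMeasure (Kernel.traj (X := fun _ => G.V) G.stepKernel 0 _))

theorem lintegral_stepKernel (n : ℕ) (h : Finset.Iic n → G.V) (g : G.V → ℝ≥0∞) :
    ∫⁻ z, g z ∂G.stepKernel n h =
      ∑ z, G.transition (h ⟨n, Finset.mem_Iic.2 le_rfl⟩) z * g z := by
  rw [lintegral_fintype]
  refine Finset.sum_congr rfl fun z _ => ?_
  rw [mul_comm]
  congr 1
  change (G.stepLaw (h ⟨n, Finset.mem_Iic.2 le_rfl⟩)).toMeasure {z} = _
  rw [PMF.toMeasure_apply_singleton _ _ (measurableSet_singleton z)]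
  rfl

/-- The Markov property of the walk at a fixed time. -/
theorem lintegral_walkLaw_step (x : G.V) (n : ℕ) (F : (Finset.Iic n → G.V) → ℝ≥0∞)
    (g : G.V → ℝ≥0∞) :
    ∫⁻ ω, F (Preorder.frestrictLe n ω) * g (ω (n + 1)) ∂G.walkLaw x =
      ∫⁻ ω, F (Preorder.frestrictLe n ω) * ∑ z, G.transition (ω n) z * g z ∂G.walkLaw x := by
  have hF : Measurable F := measurable_of_countable F
  have hg : Measurable g := measurable_of_countable g
  have hP : Measurable fun h : Finset.Iic n → G.V =>
      F h * ∑ z, G.transition (h ⟨n, Finset.mem_Iic.2 le_rfl⟩) z * g z := measurable_of_countable _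
  have hFg : Measurable fun p : (Finset.Iic n → G.V) × G.V => F p.1 * g p.2 :=
    measurable_of_countable _
  have hr : Measurable (Preorder.frestrictLe (π := fun _ : ℕ => G.V) n) :=
    Preorder.measurable_frestrictLe n
  have hpair : Measurable fun ω : ℕ → G.V =>
      (Preorder.frestrictLe (π := fun _ => G.V) n ω, ω (n + 1)) :=
    hr.prodMk (measurable_pi_apply _)
  calc _ = ∫⁻ p, F p.1 * g p.2 ∂(G.walkLaw x).map
          (fun ω => (Preorder.frestrictLe (π := fun _ => G.V) n ω, ω (n + 1))) := by
        rw [lintegral_map hFg hpair]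
    _ = ∫⁻ h, F h * ∑ z, G.transition (h ⟨n, Finset.mem_Iic.2 le_rfl⟩) z * g z
          ∂(G.walkLaw x).map (Preorder.frestrictLe (π := fun _ => G.V) n) := by
        -- The joint law of the history up to time `n` and the next position is the composition
        -- product of the history's law with the step kernel.
        unfold walkLaw
        rw [← Kernel.partialTraj_compProd_eq_map_traj (zero_le),
          Measure.lintegral_compProd hFg, Kernel.traj_map_frestrictLe_apply]
        refine lintegral_congr fun h => ?_
        dsimp only
        rw [lintegral_const_mul _ hg, lintegral_stepKernel]
    _ = _ := by
        rw [lintegral_map hP hr]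
        rfl

theorem lintegral_walkLaw_zero (x : G.V) (g : G.V → ℝ≥0∞) :
    ∫⁻ ω, g (ω 0) ∂G.walkLaw x = g x := by
  have hg : Measurable fun ω : ℕ → G.V => g (ω 0) :=
    (measurable_of_countable g).comp (measurable_pi_apply 0)
  unfold walkLaw
  rw [Kernel.lintegral_traj _ hg]
  simp [Function.updateFinset]

/-- The indicator of the event that the target `y` is avoided up to time `n`. -/
noncomputable def avoids (y : G.V) (n : ℕ) (ω : ℕ → G.V) : ℝ≥0∞ :=
  if ∀ j ≤ n, ω j ≠ y then 1 else 0

theorem hittingAfter_eq_tsum_avoids (y : G.V) (ω : ℕ → G.V) :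
    ENat.toENNReal (hittingAfter (fun (k : ℕ) (ω : ℕ → G.V) => ω k) {y} 0 ω) =
      ∑' n, G.avoids y n ω := by
  have key : ∀ m : ℕ∞, (∀ n : ℕ, (n : ℕ∞) < m ↔ ∀ j ≤ n, ω j ≠ y) →
      (m : ℝ≥0∞) = ∑' n, G.avoids y n ω := fun m hm => by
    rw [ENat.toENNReal_eq_tsum_ite]
    exact tsum_congr fun n => if_congr (hm n) rfl rfl
  refine key _ fun n => ?_
  have h := hittingAfter_le_iff (u := fun (k : ℕ) (ω : ℕ → G.V) => ω k) (s := {y}) (n := 0)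
    (ω := ω) (i := n)
  refine (not_le.symm.trans (not_congr h)).trans ?_
  simp

theorem measurable_avoids (y : G.V) (n : ℕ) : Measurable (G.avoids y n) := by
  have : MeasurableSet {ω : ℕ → G.V | ∀ j ≤ n, ω j ≠ y} := by
    have h : {ω : ℕ → G.V | ∀ j ≤ n, ω j ≠ y} = ⋂ j, ⋂ (_ : j ≤ n), (fun ω => ω j) ⁻¹' {y}ᶜ := by
      ext; simp
    rw [h]
    exact .iInter fun j => .iInter fun _ =>
      measurable_pi_apply j (measurableSet_singleton y).compl
  exact Measurable.ite this measurable_const measurable_const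

theorem hittingTime_eq_tsum (x y : G.V) :
    G.hittingTime x y = ∑' n, ∫⁻ ω, G.avoids y n ω ∂G.walkLaw x := by
  unfold hittingTime
  simp_rw [hittingAfter_eq_tsum_avoids]
  exact lintegral_tsum fun n => (G.measurable_avoids y n).aemeasurable

/-- A finite solution of the first-step equations for the target `y` is the hitting time. -/
theorem hittingTime_eq_of_firstStep (y : G.V) (f : G.V → ℝ≥0∞) (hf : ∀ x, f x ≠ ∞)
    (hy : f y = 0) (hstep : ∀ x, x ≠ y → f x = 1 + ∑ z, G.transition x z * f z) (x : G.V) :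
    G.hittingTime x y = f x := by
  set A : ℕ → ℝ≥0∞ := fun n => ∫⁻ ω, G.avoids y n ω ∂G.walkLaw x
  set R : ℕ → ℝ≥0∞ := fun n => ∫⁻ ω, G.avoids y n ω * f (ω n) ∂G.walkLaw x
  have hR0 : R 0 = f x := by
    rw [← G.lintegral_walkLaw_zero x f]
    refine lintegral_congr fun ω => ?_
    by_cases h : ω 0 = y <;> simp [avoids, h, hy]
  -- `A n` is the probability that the hitting time exceeds `n`, and `R n` is the mean remaining
  -- value of `f` on that event. One first-step equation turns `R n` into `A n` plus the next
  -- remainder.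
  have hR : ∀ n, R n = A n + R (n + 1) := by
    intro n
    have h1 : ∀ ω : ℕ → G.V, G.avoids y n ω * f (ω n)
        = G.avoids y n ω + G.avoids y n ω * ∑ z, G.transition (ω n) z * f z := by
      intro ω
      by_cases h : ∀ j ≤ n, ω j ≠ y
      · rw [hstep _ (h n le_rfl), mul_add, mul_one]
      · simp [avoids, h]
    -- As `f y = 0`, avoidance at time `n + 1` need not be imposed, so the indicator depends on the
    -- history up to `n` only.
    have h2 : ∀ ω : ℕ → G.V, G.avoids y (n + 1) ω * f (ω (n + 1))
        = G.avoids y n ω * f (ω (n + 1)) := by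
      intro ω
      by_cases h : ω (n + 1) = y
      · simp [h, hy]
      · congr 1
        unfold avoids
        refine if_congr ?_ rfl rfl
        constructor
        · exact fun H j hj => H j (by omega)
        · intro H j hj
          rcases Nat.le_succ_iff.1 hj with hj | rfl
          exacts [H j hj, h]
    have h3 := G.lintegral_walkLaw_step x n
      (fun h => if ∀ i, h i ≠ y then 1 else 0) f
    have h4 : ∀ ω : ℕ → G.V, (if ∀ i, Preorder.frestrictLe (π := fun _ => G.V) n ω i ≠ y
        then (1 : ℝ≥0∞) else 0) = G.avoids y n ω := by
      intro ω
      unfold avoids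
      exact if_congr (by simp [Preorder.frestrictLe]) rfl rfl
    simp only [h4] at h3
    change ∫⁻ ω, G.avoids y n ω * f (ω n) ∂G.walkLaw x
      = ∫⁻ ω, G.avoids y n ω ∂G.walkLaw x
        + ∫⁻ ω, G.avoids y (n + 1) ω * f (ω (n + 1)) ∂G.walkLaw x
    rw [lintegral_congr h1, lintegral_congr h2, lintegral_add_left (G.measurable_avoids y n), h3]
  have hsum : ∀ n, f x = ∑ k ∈ Finset.range n, A k + R n := by
    intro n
    induction n with
    | zero => simp [hR0]
    | succ n ih => rw [ih, hR n, Finset.sum_range_succ, add_assoc]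
  have hle : ∑' n, A n ≤ f x := by
    rw [ENNReal.tsum_eq_iSup_nat]
    exact iSup_le fun n => (hsum n).symm ▸ le_self_add
  have hA : Tendsto A atTop (𝓝 0) :=
    ENNReal.tendsto_atTop_zero_of_tsum_ne_top (ne_top_of_le_ne_top (hf x) hle)
  -- The partial sums of `A` are at most `f x < ∞`, so `A` tends to 0. Since `f` is bounded, the
  -- remainder vanishes too; no recurrence argument is needed.
  have hRA : ∀ n, R n ≤ (∑ z, f z) * A n := by
    intro n
    change _ ≤ (∑ z, f z) * ∫⁻ ω, G.avoids y n ω ∂G.walkLaw x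
    rw [← lintegral_const_mul _ (G.measurable_avoids y n)]
    refine lintegral_mono fun ω => ?_
    rw [mul_comm]
    exact mul_le_mul_left (Finset.single_le_sum (f := f) (fun _ _ => zero_le) (Finset.mem_univ _)) _
  have hM : ∑ z, f z ≠ ∞ := ENNReal.sum_ne_top.2 fun z _ => hf z
  have hR' : Tendsto R atTop (𝓝 0) := by
    refine tendsto_of_tendsto_of_tendsto_of_le_of_le tendsto_const_nhds ?_
      (fun _ => zero_le) hRA
    simpa using ENNReal.Tendsto.const_mul hA (Or.inr hM)
  have hlim : Tendsto (fun n => ∑ k ∈ Finset.range n, A k + R n) atTop (𝓝 (∑' n, A n + 0)) :=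
    (ENNReal.tendsto_nat_tsum A).add hR'
  rw [hittingTime_eq_tsum]
  refine tendsto_nhds_unique (by simpa using hlim) ?_
  simp_rw [← hsum]
  exact tendsto_const_nhds

end WeightedGraph

/-! ### Hitting matrices -/

namespace WeightedGraph

/-- `h` solves the equations `h x y = 1 + ∑ z, P x z * h z y - [x = y] / π x` of the matrix of
hitting times, cleared of denominators. -/
structure IsHittingMatrix (G : WeightedGraph) (h : G.V → G.V → ℝ) : Prop where
  nonneg : ∀ x y, 0 ≤ h x y
  diag : ∀ y, h y y = 0
  step : ∀ x y, (G.strength x : ℝ) * h x y + (if x = y then ((∑ z, G.strength z : ℕ) : ℝ) else 0)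
    = G.strength x + ∑ z, (G.w x z : ℝ) * h z y

/-- Only the off-diagonal equations and the zero diagonal enter here; the diagonal equations serve
the induction over growth steps. -/
theorem IsHittingMatrix.hittingTime_eq {G : WeightedGraph} {h : G.V → G.V → ℝ}
    (H : G.IsHittingMatrix h) (hG : ∀ x, 0 < G.strength x) (x y : G.V) :
    G.hittingTime x y = ENNReal.ofReal (h x y) := by
  refine G.hittingTime_eq_of_firstStep y (fun x => ENNReal.ofReal (h x y))
    (fun _ => ENNReal.ofReal_ne_top) (by simp [H.diag]) (fun x hx => ?_) x
  have hs : (0 : ℝ) < G.strength x := by exact_mod_cast hG x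
  have h1 : h x y = 1 + ∑ z, (G.w x z : ℝ) / G.strength x * h z y := by
    have := H.step x y
    rw [if_neg hx, add_zero] at this
    simp_rw [div_mul_eq_mul_div, ← Finset.sum_div]
    field_simp
    rw [mul_comm, this]
  have h2 : ∀ z, 0 ≤ (G.w x z : ℝ) / G.strength x * h z y :=
    fun z => mul_nonneg (by positivity) (H.nonneg z y)
  rw [h1, ENNReal.ofReal_add zero_le_one (Finset.sum_nonneg fun z _ => h2 z), ENNReal.ofReal_one,
    ENNReal.ofReal_sum_of_nonneg fun z _ => h2 z]
  congr 1
  refine Finset.sum_congr rfl fun z _ => ?_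
  rw [ENNReal.ofReal_mul (by positivity), ENNReal.ofReal_div_of_pos hs, transition,
    if_neg (hG x).ne']
  simp

theorem IsHittingMatrix.meanHittingTime_eq {G : WeightedGraph} {h : G.V → G.V → ℝ}
    (H : G.IsHittingMatrix h) (hG : ∀ x, 0 < G.strength x) (x : G.V) {K : ℝ}
    (hK : ∑ y, (G.strength y : ℝ) * h x y = ((∑ z, G.strength z : ℕ) : ℝ) * K) :
    G.meanHittingTime x = ENNReal.ofReal K := by
  have hS : 0 < ∑ z, G.strength z := Finset.sum_pos (fun z _ => hG z) ⟨x, Finset.mem_univ x⟩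
  have hS' : (0 : ℝ) < ((∑ z, G.strength z : ℕ) : ℝ) := by exact_mod_cast hS
  have h1 : K = ∑ y, (G.strength y : ℝ) / ((∑ z, G.strength z : ℕ) : ℝ) * h x y := by
    simp_rw [div_mul_eq_mul_div, ← Finset.sum_div]
    rw [hK]
    field_simp
  rw [h1, ENNReal.ofReal_sum_of_nonneg
    fun y _ => mul_nonneg (by positivity) (H.nonneg x y)]
  refine Finset.sum_congr rfl fun y _ => ?_
  rw [H.hittingTime_eq hG, ENNReal.ofReal_mul (by positivity), ENNReal.ofReal_div_of_pos hS',
    ENNReal.ofReal_natCast, ENNReal.ofReal_natCast]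
  rfl

/-! ### One growth step -/

section Grow

variable (δ : ℕ) (G : WeightedGraph)

theorem sum_grow {M : Type*} [AddCommMonoid M] (f : CoronaVertex G (unitComplete 2) → M) :
    ∑ q, f q = ∑ z, f (.inl z) + ∑ i, ∑ k, (f (.inr (⟨i, k⟩, 0)) + f (.inr (⟨i, k⟩, 1))) := by
  rw [Fintype.sum_sum_type, Fintype.sum_prod_type, Fintype.sum_sigma]
  congr 1
  exact Finset.sum_congr rfl fun i _ => Finset.sum_congr rfl fun k _ => Fin.sum_univ_two _

variable {G} in
theorem sum_copies_const (hG : ∀ x, Even (G.strength x)) (i : G.V) (r : ℝ) :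
    ∑ _k : Fin (G.strength i / 2), (r + r) = G.strength i * r := by
  have h : ((2 * (G.strength i / 2) : ℕ) : ℝ) = G.strength i := by
    rw [Nat.two_mul_div_two_of_even (hG i)]
  push_cast at h
  rw [Finset.sum_const, Finset.card_univ, Fintype.card_fin, nsmul_eq_mul, ← h]
  ring

/-- A neighbour sum at an old vertex. -/
theorem sum_grow_inl (x : G.V) (f : CoronaVertex G (unitComplete 2) → ℝ) :
    ∑ q, ((grow δ G).w (.inl x : CoronaVertex G (unitComplete 2)) q : ℝ) * f q
      = (1 + δ) * ∑ z, (G.w x z : ℝ) * f (.inl z)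
        + ∑ k, (f (.inr (⟨x, k⟩, 0)) + f (.inr (⟨x, k⟩, 1))) := by
  refine (sum_grow G _).trans ?_
  congr 1
  · rw [Finset.mul_sum]
    refine Finset.sum_congr rfl fun z _ => ?_
    simp only [reinforcedWeight, coronaWeight]
    push_cast
    ring
  · rw [Finset.sum_eq_single x]
    · simp [reinforcedWeight, coronaWeight]
    · intro i _ hi
      simp [reinforcedWeight, coronaWeight, hi]
    · simp

/-- A neighbour sum at a new vertex. -/
theorem sum_grow_inr (c : Σ i : G.V, Fin (G.strength i / 2)) (u : Fin 2)
    (f : CoronaVertex G (unitComplete 2) → ℝ) :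
    ∑ q, ((grow δ G).w (.inr (c, u) : CoronaVertex G (unitComplete 2)) q : ℝ) * f q
      = f (.inl c.1) + f (.inr (c, u.rev)) := by
  refine (Fintype.sum_sum_type _).trans ?_
  congr 1
  · rw [Finset.sum_eq_single c.1]
    · simp [reinforcedWeight, coronaWeight]
    · intro i _ hi
      simp [reinforcedWeight, coronaWeight, hi.symm]
    · simp
  · rw [Fintype.sum_prod_type, Finset.sum_eq_single c]
    · rw [Fin.sum_univ_two]
      fin_cases u <;> simp [reinforcedWeight, coronaWeight]
    · intro d _ hd
      simp [reinforcedWeight, coronaWeight, hd.symm]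
    · simp

variable {G} in
theorem total_strength_grow (hG : ∀ x, Even (G.strength x)) :
    ∑ q, (grow δ G).strength q = (δ + 4) * ∑ x, G.strength x := by
  refine (sum_grow G _).trans ?_
  have h1 : ∀ i, ∑ k : Fin (G.strength i / 2),
      ((grow δ G).strength (Sum.inr (⟨i, k⟩, 0) : CoronaVertex G (unitComplete 2))
        + (grow δ G).strength (Sum.inr (⟨i, k⟩, 1) : CoronaVertex G (unitComplete 2)))
      = 2 * G.strength i := by
    intro i
    have := Nat.two_mul_div_two_of_even (hG i)
    refine (Finset.sum_congr rfl fun k _ => congrArg₂ (· + ·)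
      (strength_grow_inr δ G ⟨i, k⟩ 0) (strength_grow_inr δ G ⟨i, k⟩ 1)).trans ?_
    simp
    omega
  rw [Finset.sum_congr rfl fun i _ => h1 i,
    Finset.sum_congr rfl fun x _ => strength_grow_inl δ G hG x, ← Finset.mul_sum, ← Finset.mul_sum]
  ring

variable {G} in
theorem card_grow (hG : ∀ x, Even (G.strength x)) :
    Fintype.card (grow δ G).V = Fintype.card G.V + ∑ x, G.strength x := by
  change Fintype.card (CoronaVertex G (unitComplete 2)) = _
  rw [Fintype.card_sum, Fintype.card_prod, Fintype.card_sigma, Finset.sum_mul]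
  congr 1
  refine Finset.sum_congr rfl fun i _ => ?_
  have := Nat.two_mul_div_two_of_even (hG i)
  simp
  omega

/-- The expected time to reach a new vertex from the old vertex it is attached to. -/
noncomputable def attachTime : ℝ := 2 / 3 * (δ + 4) * ((∑ z, G.strength z : ℕ) : ℝ) - 2

/-- The hitting times in `grow δ G` in terms of the hitting times `h` in `G`. -/
noncomputable def growHit (h : G.V → G.V → ℝ) :
    CoronaVertex G (unitComplete 2) → CoronaVertex G (unitComplete 2) → ℝ
  | .inl x, .inl y => (δ + 4) / (δ + 1) * h x y
  | .inr (c, _), .inl y => 2 + (δ + 4) / (δ + 1) * h c.1 y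
  | .inl x, .inr (d, _) => (δ + 4) / (δ + 1) * h x d.1 + attachTime δ G
  | .inr (c, u), .inr (d, v) => 2 + (δ + 4) / (δ + 1) * h c.1 d.1 + attachTime δ G
      -- Inside one triangle the true values are 0 and, for the twin, `1 + D/2`, where `D =
      -- attachTime`: the twin moves to the target or to the attachment vertex with probability 1/2
      -- each.
      - if c = d then (if u = v then 2 + attachTime δ G else 1 + attachTime δ G / 2) else 0

variable {G}

theorem sum_copies_ite (x : G.V) (d : Σ i : G.V, Fin (G.strength i / 2)) (r : ℝ) :
    ∑ k : Fin (G.strength x / 2), (if (⟨x, k⟩ : Σ i : G.V, Fin (G.strength i / 2)) = d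
      then r else 0) = if x = d.1 then r else 0 := by
  obtain ⟨j, l⟩ := d
  by_cases h : x = j
  · subst h
    simp
  · simp [h]

/-- The two corrections in the target's triangle add up to `(2 + D) + (1 + D/2)`, with `D =
attachTime`. This is the total strength of the grown graph, so it can match the diagonal term of the
old equation. -/
theorem sum_copies_growHit (hG : ∀ x, Even (G.strength x)) (h : G.V → G.V → ℝ) (x : G.V)
    (d : Σ i : G.V, Fin (G.strength i / 2)) (v : Fin 2) :
    ∑ k, (growHit δ G h (.inr (⟨x, k⟩, 0)) (.inr (d, v))
        + growHit δ G h (.inr (⟨x, k⟩, 1)) (.inr (d, v)))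
      = G.strength x * (2 + (δ + 4) / (δ + 1) * h x d.1 + attachTime δ G)
        - if x = d.1 then 3 + 3 / 2 * attachTime δ G else 0 := by
  rw [← sum_copies_const hG, ← sum_copies_ite, ← Finset.sum_sub_distrib]
  refine Finset.sum_congr rfl fun k _ => ?_
  simp only [growHit]
  split_ifs <;> fin_cases v <;> simp at * <;> ring

theorem growHit_new_new (h : G.V → G.V → ℝ) (c d : Σ i : G.V, Fin (G.strength i / 2)) (u : Fin 2) :
    growHit δ G h (.inr (c, u)) (.inr (d, 0)) + growHit δ G h (.inr (c, u)) (.inr (d, 1))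
      = ((2 + (δ + 4) / (δ + 1) * h c.1 d.1 + attachTime δ G)
        + (2 + (δ + 4) / (δ + 1) * h c.1 d.1 + attachTime δ G))
        - if d = c then 3 + 3 / 2 * attachTime δ G else 0 := by
  simp only [growHit, eq_comm (a := c)]
  split_ifs <;> fin_cases u <;> simp at * <;> ring

/-- At an old vertex each equation is `(1 + δ) a = δ + 4` times the corresponding old equation,
after the triangle terms are absorbed. At a new vertex it is a direct computation in its triangle.
-/
theorem IsHittingMatrix.grow {h : G.V → G.V → ℝ} (H : G.IsHittingMatrix h)
    (hG : ∀ x, Even (G.strength x)) (hS : 0 < ∑ z, G.strength z) :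
    (WeightedGraph.grow δ G).IsHittingMatrix (growHit δ G h) := by
  have hS1 : (1 : ℝ) ≤ ((∑ z, G.strength z : ℕ) : ℝ) := by exact_mod_cast hS
  have hδ : (0 : ℝ) ≤ δ := Nat.cast_nonneg δ
  have hD : 0 ≤ attachTime δ G := by
    unfold attachTime
    nlinarith
  have ha : (δ + 1 : ℝ) * ((δ + 4) / (δ + 1)) = δ + 4 := by field_simp
  have ha0 : (0 : ℝ) ≤ (δ + 4) / (δ + 1) := by positivity
  -- This is Kac's formula at a new vertex, of strength 2: the return time `1 + D/2 + (1 + D/2)/2`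
  -- equals half the new total strength. It determines `attachTime`.
  have hDS : (δ + 4) * ((∑ z, G.strength z : ℕ) : ℝ) = 3 + 3 / 2 * attachTime δ G := by
    unfold attachTime
    ring
  have hS' := total_strength_grow δ hG
  refine ⟨?_, ?_, ?_⟩
  · rintro (x | ⟨c, u⟩) (y | ⟨d, v⟩)
    · exact mul_nonneg ha0 (H.nonneg x y)
    · exact add_nonneg (mul_nonneg ha0 (H.nonneg x d.1)) hD
    · exact add_nonneg zero_le_two (mul_nonneg ha0 (H.nonneg c.1 y))
    · have := mul_nonneg ha0 (H.nonneg c.1 d.1)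
      simp only [growHit]
      split_ifs <;> linarith
  · rintro (x | ⟨c, u⟩)
    · simp [growHit, H.diag]
    · simp [growHit, H.diag]
  · rintro p q
    rw [hS', Nat.cast_mul]
    push_cast only [Nat.cast_add, Nat.cast_ofNat]
    rw [hDS]
    rcases p with x | ⟨c, u⟩
    · refine (congrArg₂ (fun s r : ℝ => s * _ + _ = s + r)
        ((congrArg Nat.cast (strength_grow_inl δ G hG x)).trans (Nat.cast_mul _ _))
        (sum_grow_inl δ G x _)).mpr ?_
      push_cast
      rcases q with y | ⟨d, v⟩
      · have e := H.step x y
        simp only [growHit, sum_copies_const hG, Sum.inl.injEq, mul_left_comm (_ : ℝ) (_ / _),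
          ← Finset.mul_sum]
        by_cases hxy : x = y
        · rw [if_pos hxy] at e ⊢
          linear_combination (1 + δ) * ((δ + 4) / (δ + 1)) * e + G.strength x * ha
            - ((∑ z, G.strength z : ℕ) : ℝ) * ha - hDS
        · rw [if_neg hxy] at e ⊢
          linear_combination (1 + δ) * ((δ + 4) / (δ + 1)) * e + G.strength x * ha
      · have e := H.step x d.1
        have hw : ∑ z, (G.w x z : ℝ) = G.strength x := by rw [strength, Nat.cast_sum]
        rw [sum_copies_growHit δ hG]
        simp only [growHit, reduceCtorEq, if_false, mul_add, Finset.sum_add_distrib,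
          ← Finset.sum_mul, hw, mul_left_comm (_ : ℝ) (_ / _), ← Finset.mul_sum]
        -- If the target hangs at `x`, the old diagonal term, scaled by `δ + 4`, cancels the
        -- correction from the target's triangle.
        by_cases hxd : x = d.1
        · rw [if_pos hxd] at e ⊢
          linear_combination (1 + δ) * ((δ + 4) / (δ + 1)) * e + G.strength x * ha
            - ((∑ z, G.strength z : ℕ) : ℝ) * ha - hDS
        · rw [if_neg hxd] at e ⊢
          linear_combination (1 + δ) * ((δ + 4) / (δ + 1)) * e + G.strength x * ha
    · refine (congrArg₂ (fun s r : ℝ => s * _ + _ = s + r)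
        (congrArg Nat.cast (strength_grow_inr δ G c u))
        (sum_grow_inr δ G c u _)).mpr ?_
      rcases q with y | ⟨d, v⟩
      · simp only [growHit, reduceCtorEq, if_false]
        push_cast
        ring
      · simp only [growHit, Sum.inr.injEq, Prod.mk.injEq]
        push_cast
        by_cases hcd : c = d
        · subst hcd
          fin_cases u <;> fin_cases v <;> simp [H.diag] <;> ring
        · simp only [hcd, false_and, if_false]
          ring

/-- If the weighted row sums of `h` are constant, so are those
of `growHit δ G h`. -/
theorem sum_growHit {h : G.V → G.V → ℝ} (hG : ∀ x, Even (G.strength x)) {K : ℝ}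
    (hK : ∀ x, ∑ y, (G.strength y : ℝ) * h x y = ((∑ z, G.strength z : ℕ) : ℝ) * K)
    (p : CoronaVertex G (unitComplete 2)) :
    ∑ q, ((WeightedGraph.grow δ G).strength q : ℝ) * growHit δ G h p q
      = ((∑ q, (WeightedGraph.grow δ G).strength q : ℕ) : ℝ)
        * ((δ + 4) / (δ + 1) * K + 4 / 3 * ((∑ z, G.strength z : ℕ) : ℝ) - 4 / (δ + 4)) := by
  have hδ : (0 : ℝ) ≤ δ := Nat.cast_nonneg δ
  have hDS : (δ + 4) * ((∑ z, G.strength z : ℕ) : ℝ) = 3 + 3 / 2 * attachTime δ G := by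
    unfold attachTime
    ring
  have hb : (δ + 4 : ℝ) * (4 / (δ + 4)) = 4 := by field_simp
  have hsum : ∑ z, (G.strength z : ℝ) = ((∑ z, G.strength z : ℕ) : ℝ) := by push_cast; rfl
  have split : ∑ q, ((WeightedGraph.grow δ G).strength q : ℝ) * growHit δ G h p q
      = ∑ y, (δ + 2) * (G.strength y : ℝ) * growHit δ G h p (.inl y)
        + ∑ i, ∑ k, 2 * (growHit δ G h p (.inr (⟨i, k⟩, 0)) + growHit δ G h p (.inr (⟨i, k⟩, 1))) := by
    refine (sum_grow G _).trans (congrArg₂ (· + ·) ?_ ?_)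
    · refine Finset.sum_congr rfl fun y _ => ?_
      refine congrArg (fun s : ℝ => s * _)
        ((congrArg Nat.cast (strength_grow_inl δ G hG y)).trans ?_)
      push_cast
      rfl
    · refine Finset.sum_congr rfl fun i _ => Finset.sum_congr rfl fun k _ => ?_
      rw [mul_add]
      exact congrArg₂ (fun s t : ℝ => s * _ + t * _)
        ((congrArg Nat.cast (strength_grow_inr δ G ⟨i, k⟩ 0)).trans Nat.cast_two)
        ((congrArg Nat.cast (strength_grow_inr δ G ⟨i, k⟩ 1)).trans Nat.cast_two)
  rw [split, total_strength_grow δ hG, Nat.cast_mul]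
  push_cast only [Nat.cast_add, Nat.cast_ofNat]
  simp only [← Finset.mul_sum]
  rcases p with x | ⟨c, u⟩
  · simp only [growHit, sum_copies_const hG, mul_add, Finset.sum_add_distrib, mul_assoc,
      ← Finset.mul_sum, ← Finset.sum_mul, mul_left_comm (_ : ℝ) (_ / _), hK, hsum]
    unfold attachTime
    linear_combination ((∑ z, G.strength z : ℕ) : ℝ) * hb
  -- From a new vertex every target costs 2 more, but the corrections in its own triangle, weighted
  -- by strength 2, remove twice the total strength. The two effects cancel, so the row sum does not
  -- depend on the start.
  · have e : ∑ i, ∑ k, (growHit δ G h (.inr (c, u)) (.inr (⟨i, k⟩, 0))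
          + growHit δ G h (.inr (c, u)) (.inr (⟨i, k⟩, 1)))
        = ∑ i, G.strength i * (2 + (δ + 4) / (δ + 1) * h c.1 i + attachTime δ G)
          - (3 + 3 / 2 * attachTime δ G) := by
      refine (Finset.sum_congr rfl fun i _ => Finset.sum_congr rfl fun k _ =>
        growHit_new_new δ h c ⟨i, k⟩ u).trans ?_
      simp only [Finset.sum_sub_distrib, sum_copies_const hG, sum_copies_ite,
        Finset.sum_ite_eq', Finset.mem_univ, if_true]
    rw [e]
    simp only [growHit, mul_add, Finset.sum_add_distrib, mul_assoc,
      ← Finset.mul_sum, ← Finset.sum_mul, mul_left_comm (_ : ℝ) (_ / _), hK, hsum]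
    unfold attachTime
    linear_combination ((∑ z, G.strength z : ℕ) : ℝ) * hb

end Grow

end WeightedGraph

/-! ### Induction along the networks and linear growth -/

namespace WeightedGraph

theorem total_strength_network (δ n : ℕ) :
    ∑ x, (network δ n).strength x = 6 * (δ + 4) ^ n := by
  induction n with
  | zero =>
    change ∑ x : Fin 3, ∑ y : Fin 3, (if x = y then 0 else 1) = 6 * (δ + 4) ^ 0
    simp only [pow_zero]
    rfl
  | succ n ih =>
    refine (total_strength_grow δ fun x => (network_strength δ n x).1).trans ?_
    rw [ih]
    ring

theorem card_network (δ n : ℕ) :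
    (Fintype.card (network δ n).V : ℝ) = 3 + 6 * ((δ + 4) ^ n - 1) / (δ + 3) := by
  have hδ : (δ + 3 : ℝ) ≠ 0 := by positivity
  induction n with
  | zero =>
    have h : Fintype.card (network δ 0).V = 3 := Fintype.card_fin 3
    simp [h]
  | succ n ih =>
    have h : Fintype.card (network δ (n + 1)).V
        = Fintype.card (network δ n).V + 6 * (δ + 4) ^ n := by
      rw [← total_strength_network]
      exact card_grow δ fun x => (network_strength δ n x).1
    rw [h]
    push_cast
    rw [ih]
    field_simp
    ring

/-- The closed form of the mean hitting time of `network δ n`. -/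
noncomputable def kemeny (δ n : ℕ) : ℝ :=
  (4 * (δ : ℝ) * ((δ : ℝ) + 1) ^ (n + 1)
      + 24 * ((δ : ℝ) + 4) ^ n * ((δ : ℝ) + 1) ^ (n + 1)
      - 12 * ((δ : ℝ) + 2) * ((δ : ℝ) + 4) ^ n)
    / (3 * (δ : ℝ) * ((δ : ℝ) + 4) * ((δ : ℝ) + 1) ^ n)

theorem kemeny_zero {δ : ℕ} (hδ : 0 < δ) : kemeny δ 0 = 4 / 3 := by
  have : (0 : ℝ) < δ := by exact_mod_cast hδ
  unfold kemeny
  field_simp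
  ring

theorem kemeny_succ {δ : ℕ} (hδ : 0 < δ) (n : ℕ) :
    kemeny δ (n + 1) = (δ + 4) / (δ + 1) * kemeny δ n + 4 / 3 * (6 * (δ + 4) ^ n) - 4 / (δ + 4) := by
  have : (0 : ℝ) < δ := by exact_mod_cast hδ
  unfold kemeny
  field_simp
  ring

theorem exists_isHittingMatrix_network {δ : ℕ} (hδ : 0 < δ) (n : ℕ) :
    ∃ h, (network δ n).IsHittingMatrix h ∧ ∀ x, ∑ y, ((network δ n).strength y : ℝ) * h x y
      = ((∑ z, (network δ n).strength z : ℕ) : ℝ) * kemeny δ n := by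
  induction n with
  | zero =>
    have hs : ∀ x, (network δ 0).strength x = 2 := by
      intro x
      change Fin 3 at x
      change ∑ y : Fin 3, (if x = y then 0 else 1) = 2
      fin_cases x <;> rfl
    -- On the triangle each step hits the target with probability 1/2, hence 2. Natural-number
    -- values let the equations be decided by evaluation.
    let h : Fin 3 → Fin 3 → ℕ := fun x y => if x = y then 0 else 2
    have step : ∀ x y : Fin 3, 2 * h x y + (if x = y then 6 else 0)
        = 2 + ∑ z : Fin 3, (if x = z then 0 else 1) * h z y := by decide
    have row : ∀ x : Fin 3, ∑ y : Fin 3, 2 * h x y = 8 := by decide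
    refine ⟨fun x y => (h x y : ℝ), ⟨fun x y => Nat.cast_nonneg _, fun y => ?_, fun x y => ?_⟩,
      fun x => ?_⟩
    · exact Nat.cast_eq_zero.2 (if_pos rfl)
    · rw [total_strength_network, hs, pow_zero]
      exact_mod_cast step x y
    · rw [total_strength_network, kemeny_zero hδ, Finset.sum_congr rfl fun y _ => by rw [hs y]]
      have e : ∑ y : Fin 3, ((2 : ℕ) : ℝ) * (h x y : ℝ) = 8 := by exact_mod_cast row x
      refine e.trans ?_
      norm_num
  | succ n ih =>
    obtain ⟨h, H, hK⟩ := ih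
    have hG := fun x => (network_strength δ n x).1
    have hT := total_strength_network δ n
    refine ⟨growHit δ (network δ n) h, H.grow δ hG (hT ▸ by positivity), fun x => ?_⟩
    refine (sum_growHit δ hG hK x).trans ?_
    rw [hT, kemeny_succ hδ]
    push_cast
    rfl

theorem meanHittingTime_network {δ : ℕ} (hδ : 0 < δ) (n : ℕ) (x : (network δ n).V) :
    (network δ n).meanHittingTime x = ENNReal.ofReal (kemeny δ n) := by
  obtain ⟨h, H, hK⟩ := exists_isHittingMatrix_network hδ n
  exact H.meanHittingTime_eq (fun x => (network_strength δ n x).2) x (hK x)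

theorem kemeny_eq {δ : ℕ} (hδ : 0 < δ) (n : ℕ) :
    kemeny δ n = (4 * (δ + 1) / (3 * (δ + 4)) * ((δ + 4 : ℝ) ^ n)⁻¹ + 8 * (δ + 1) / (δ * (δ + 4))
      - 4 * (δ + 2) / (δ * (δ + 4)) * ((δ + 1 : ℝ) ^ n)⁻¹) * (δ + 4) ^ n := by
  have : (0 : ℝ) < δ := by exact_mod_cast hδ
  unfold kemeny
  field_simp
  ring

/-- Ensures that `ENNReal.ofReal` does not truncate, so the real limit can be read off. -/
theorem kemeny_nonneg (δ n : ℕ) : 0 ≤ kemeny δ n := by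
  have h1 : (1 : ℝ) ≤ (δ + 1) ^ n := one_le_pow₀ (by linarith [(Nat.cast_nonneg δ : (0 : ℝ) ≤ δ)])
  have h2 : 12 * (δ + 2 : ℝ) ≤ 24 * (δ + 1) ^ (n + 1) := by
    rw [pow_succ]
    nlinarith [(Nat.cast_nonneg δ : (0 : ℝ) ≤ δ)]
  refine div_nonneg ?_ (by positivity)
  have h3 := mul_le_mul_of_nonneg_left h2 (by positivity : (0 : ℝ) ≤ (δ + 4) ^ n)
  have h4 : (0 : ℝ) ≤ 4 * δ * (δ + 1) ^ (n + 1) := by positivity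
  linarith

/-- After division of numerator and denominator by `(δ+4)^n`, the remaining powers decay and the
ratio of leading coefficients is left. The term in `(δ+1)^n` decays because `δ > 0`. -/
theorem tendsto_kemeny_div_card {δ : ℕ} (hδ : 0 < δ) :
    Tendsto (fun n => kemeny δ n / (Fintype.card (network δ n).V : ℝ)) atTop
      (𝓝 (8 * (δ + 1) / (δ * (δ + 4)) / (6 / (δ + 3)))) := by
  have hδ' : (0 : ℝ) < δ := by exact_mod_cast hδ
  have hq : Tendsto (fun n : ℕ => ((δ + 4 : ℝ) ^ n)⁻¹) atTop (𝓝 0) :=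
    (tendsto_pow_atTop_atTop_of_one_lt (by linarith)).inv_tendsto_atTop
  have hr : Tendsto (fun n : ℕ => ((δ + 1 : ℝ) ^ n)⁻¹) atTop (𝓝 0) :=
    (tendsto_pow_atTop_atTop_of_one_lt (by linarith)).inv_tendsto_atTop
  have hnum := ((hq.const_mul (4 * (δ + 1) / (3 * (δ + 4)) : ℝ)).add_const
    (8 * (δ + 1) / (δ * (δ + 4)) : ℝ)).sub (hr.const_mul (4 * (δ + 2) / (δ * (δ + 4)) : ℝ))
  have hden := (hq.const_mul (3 - 6 / (δ + 3) : ℝ)).add_const (6 / (δ + 3) : ℝ)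
  have hlim := hnum.div hden (by rw [mul_zero, zero_add]; positivity)
  simp only [mul_zero, zero_add, sub_zero] at hlim
  refine hlim.congr fun n => ?_
  have hp : ((δ + 4 : ℝ) ^ n) ≠ 0 := by positivity
  have hc : (Fintype.card (network δ n).V : ℝ)
      = ((3 - 6 / (δ + 3)) * ((δ + 4 : ℝ) ^ n)⁻¹ + 6 / (δ + 3)) * (δ + 4) ^ n := by
    rw [card_network]
    field_simp
    ring
  rw [hc, kemeny_eq hδ, mul_div_mul_right _ _ hp]
  rfl

end WeightedGraph

theorem theorem3 (δ : ℕ) (hδ : 0 < δ) :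
    (∀ (n : ℕ) (x : (WeightedGraph.network δ n).V),
      (WeightedGraph.network δ n).meanHittingTime x = ENNReal.ofReal
        ((4 * (δ : ℝ) * ((δ : ℝ) + 1) ^ (n + 1)
            + 24 * ((δ : ℝ) + 4) ^ n * ((δ : ℝ) + 1) ^ (n + 1)
            - 12 * ((δ : ℝ) + 2) * ((δ : ℝ) + 4) ^ n)
          / (3 * (δ : ℝ) * ((δ : ℝ) + 4) * ((δ : ℝ) + 1) ^ n))) ∧
    ∃ c : ℝ, 0 < c ∧ ∀ x : (n : ℕ) → (WeightedGraph.network δ n).V,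
      Tendsto (fun n : ℕ => ((WeightedGraph.network δ n).meanHittingTime (x n)).toReal
          / (Fintype.card (WeightedGraph.network δ n).V : ℝ))
        atTop (𝓝 c) := by
  have hδ' : (0 : ℝ) < δ := by exact_mod_cast hδ
  refine ⟨fun n x => WeightedGraph.meanHittingTime_network hδ n x,
    8 * (δ + 1) / (δ * (δ + 4)) / (6 / (δ + 3)), by positivity, fun x => ?_⟩
  simp_rw [WeightedGraph.meanHittingTime_network hδ,
    ENNReal.toReal_ofReal (WeightedGraph.kemeny_nonneg δ _)]
  exact WeightedGraph.tendsto_kemeny_div_card hδ
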